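/- All topological groups are assumed to be Hausdorff. A topological group $G$ is called \emph{c-compact} if for every topological group $H$ the projection $\pi_H : G \times H \to H$ maps closed subgroups of $G \times H$ onto closed subgroups of $H$. A topological group $G$ is called \emph{maximally almost periodic} if it admits a continuous injective homomorphism $m : G \to K$ into a compact group $K$. Corollary. Every topological group $G$ that is c-compact and maximally almost periodic is compact. -/

import Mathlib

universe u v

/-- A topological group `G` is c-compact if for every Hausdorff topological group `H` the
projection `G × H → H` maps closed subgroups of `G × H` onto closed subgroups of `H`. -/
def IsCCompactGroup (G : Type u) [Group G] [TopologicalSpace G] : Prop :=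
  ∀ (H : Type u) [Group H] [TopologicalSpace H] [IsTopologicalGroup H] [T2Space H]
    (S : Subgroup (G × H)),
    IsClosed (S : Set (G × H)) → IsClosed (S.map (MonoidHom.snd G H) : Set H)

/-- A topological group `G` is maximally almost periodic if it admits a continuous injective
homomorphism into a compact Hausdorff topological group. -/
def IsMaximallyAlmostPeriodic (G : Type u) [Group G] [TopologicalSpace G] : Prop :=
  ∃ (K : Type v) (_ : Group K) (_ : TopologicalSpace K) (_ : IsTopologicalGroup K)
    (_ : T2Space K) (_ : CompactSpace K) (m : G →* K),
    Continuous m ∧ Function.Injective m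

/-! By c-compactness `m` has closed range, so it may be taken to be a continuous bijection onto a
compact group; it remains to see that its inverse is continuous. The topology of `G` is detected by
continuous isometric actions `q` on complete metric spaces with a dense orbit
(`exists_isometric_action`). The graph of `q ∘ m⁻¹` is the range of `(m, q)`, hence closed, again by
c-compactness (`IsCCompactGroup.isClosed_graph`).

If `G` is separable, so is the space acted on, and a Baire category closed graph theorem
(`MonoidHom.continuous_of_isClosed_graph`) makes `q ∘ m⁻¹` continuous. In general, a countable
subset of `G` lies in a separable closed subgroup, which inherits the hypotheses and is therefore
compact. So every sequence in the dense orbit lies in a compact set; the space, and with it its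
isometry group, is compact, and a closed graph into a compact space already gives continuity. -/

open Topology Filter Set Pointwise Uniformity
open scoped BoundedContinuousFunction

/-! ### Isometry groups under pointwise convergence -/

/-- The topology of pointwise convergence on the group of isometries. -/
instance IsometryEquiv.pointwiseTopology {X : Type*} [PseudoMetricSpace X] :
    TopologicalSpace (X ≃ᵢ X) :=
  TopologicalSpace.induced (fun f x => f x) inferInstance

namespace IsometryEquiv

section Group

variable {X : Type*} [PseudoMetricSpace X]

theorem tendsto_iff_forall_tendsto_apply {ι : Type*} {l : Filter ι} {f : ι → X ≃ᵢ X}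
    {g : X ≃ᵢ X} : Tendsto f l (𝓝 g) ↔ ∀ x, Tendsto (fun i => f i x) l (𝓝 (g x)) := by
  rw [nhds_induced, tendsto_comap_iff, tendsto_pi_nhds]
  rfl

theorem continuous_apply_const (x : X) : Continuous fun f : X ≃ᵢ X => f x :=
  (continuous_apply x).comp continuous_induced_dom

theorem continuous_iff_forall_apply {Y : Type*} [TopologicalSpace Y] {f : Y → X ≃ᵢ X} :
    Continuous f ↔ ∀ x, Continuous fun y => f y x := by
  rw [continuous_induced_rng, continuous_pi_iff]
  rfl

theorem dist_inv_apply (f : X ≃ᵢ X) (x y : X) : dist (f⁻¹ x) y = dist x (f y) := by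
  rw [← f.isometry.dist_eq (f⁻¹ x) y, ← IsometryEquiv.mul_apply, mul_inv_cancel]
  rfl

instance : IsTopologicalGroup (X ≃ᵢ X) where
  continuous_mul := by
    rw [continuous_iff_continuousAt]
    rintro ⟨f, g⟩
    refine tendsto_iff_forall_tendsto_apply.2 fun x => ?_
    rw [tendsto_iff_dist_tendsto_zero]
    have hg : Tendsto (fun p : (X ≃ᵢ X) × (X ≃ᵢ X) => dist (p.2 x) (g x)) (𝓝 (f, g)) (𝓝 0) :=
      tendsto_iff_dist_tendsto_zero.1
        (((continuous_apply_const x).comp continuous_snd).tendsto (f, g))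
    have hf : Tendsto (fun p : (X ≃ᵢ X) × (X ≃ᵢ X) => dist (p.1 (g x)) (f (g x))) (𝓝 (f, g))
        (𝓝 0) :=
      tendsto_iff_dist_tendsto_zero.1
        (((continuous_apply_const (g x)).comp continuous_fst).tendsto (f, g))
    refine squeeze_zero (fun _ => dist_nonneg) (fun p => ?_) (by simpa using hg.add hf)
    calc dist ((p.1 * p.2) x) ((f * g) x)
        ≤ dist (p.1 (p.2 x)) (p.1 (g x)) + dist (p.1 (g x)) (f (g x)) := dist_triangle _ _ _
      _ = _ := by rw [p.1.isometry.dist_eq]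
  continuous_inv := by
    rw [continuous_iff_continuousAt]
    intro f
    refine tendsto_iff_forall_tendsto_apply.2 fun x => ?_
    rw [tendsto_iff_dist_tendsto_zero]
    have hf : Tendsto (fun p : X ≃ᵢ X => dist (p (f⁻¹ x)) (f (f⁻¹ x))) (𝓝 f) (𝓝 0) :=
      tendsto_iff_dist_tendsto_zero.1 ((continuous_apply_const (f⁻¹ x)).tendsto f)
    refine hf.congr fun p => ?_
    rw [dist_inv_apply, dist_comm]
    congr 1
    exact f.apply_symm_apply x

end Group

variable {X : Type*} [MetricSpace X]

instance : T2Space (X ≃ᵢ X) :=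
  T2Space.of_injective_continuous (f := fun (f : X ≃ᵢ X) x => f x)
    DFunLike.coe_injective continuous_induced_dom

/-- A filter of isometries converges if it converges pointwise together with the inverses. -/
theorem exists_le_nhds {F : Filter (X ≃ᵢ X)} [NeBot F]
    (h : ∀ x, ∃ y, Tendsto (fun f : X ≃ᵢ X => f x) F (𝓝 y))
    (h' : ∀ x, ∃ y, Tendsto (fun f : X ≃ᵢ X => f⁻¹ x) F (𝓝 y)) : ∃ p, F ≤ 𝓝 p := by
  choose p hp using h
  choose q hq using h'
  -- The adjoint relation between `f` and `f⁻¹` survives in the limit and makes `p` and `q` mutually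
  -- inverse.
  have hpq : ∀ x y, dist (q x) y = dist x (p y) := fun x y =>
    tendsto_nhds_unique ((hq x).dist tendsto_const_nhds)
      ((tendsto_const_nhds.dist (hp y)).congr fun f => (dist_inv_apply f x y).symm)
  have hiso : Isometry p := Isometry.of_dist_eq fun x y =>
    tendsto_nhds_unique ((hp x).dist (hp y))
      (tendsto_const_nhds.congr fun f => (f.isometry.dist_eq x y).symm)
  refine ⟨IsometryEquiv.mk ⟨p, q, fun x => ?_, fun x => ?_⟩ hiso, ?_⟩
  · rw [← dist_eq_zero, hpq, dist_self]
  · rw [← dist_eq_zero, dist_comm, ← hpq, dist_self]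
  · exact tendsto_id'.1 (tendsto_iff_forall_tendsto_apply.2 hp)

instance [CompactSpace X] : CompactSpace (X ≃ᵢ X) where
  isCompact_univ := by
    refine isCompact_iff_ultrafilter_le_nhds.2 fun F _ => ?_
    have hlim : ∀ e : (X ≃ᵢ X) → X, ∃ y, Tendsto e F (𝓝 y) := fun e =>
      ⟨_, (F.map e).le_nhds_lim⟩
    obtain ⟨p, hp⟩ := exists_le_nhds (F := (F : Filter (X ≃ᵢ X))) (fun x => hlim _)
      (fun x => hlim _)
    exact ⟨p, mem_univ p, hp⟩

/-- Isometries carry a point near `a k` to a point equally near the image of `a k`, so control on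
the dense sequence makes every image filter Cauchy. -/
theorem exists_tendsto_of_denseRange [CompleteSpace X] {ι : Type*} {F : Filter ι} [NeBot F]
    {a : ℕ → X} (ha : DenseRange a) {e : ι → X ≃ᵢ X}
    (h : ∀ k n : ℕ, ∃ y, ∀ᶠ i in F, dist (e i (a k)) y < 1 / (n + 1 : ℝ)) (x : X) :
    ∃ y, Tendsto (fun i => e i x) F (𝓝 y) := by
  refine CompleteSpace.complete (Metric.cauchy_iff.2 ⟨inferInstance, fun ε hε => ?_⟩)
  obtain ⟨k, hk⟩ := ha.exists_dist_lt x (ε := ε / 4) (by linarith)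
  obtain ⟨n, hn⟩ := exists_nat_one_div_lt (show 0 < ε / 4 by linarith)
  obtain ⟨y, hy⟩ := h k n
  refine ⟨_, image_mem_map hy, ?_⟩
  rintro _ ⟨i, hi, rfl⟩ _ ⟨j, hj, rfl⟩
  have h1 := (e i).isometry.dist_eq x (a k)
  have h2 := (e j).isometry.dist_eq x (a k)
  change dist (e i (a k)) y < _ at hi
  change dist (e j (a k)) y < _ at hj
  change dist (e i x) (e j x) < ε
  have := dist_triangle4 (e i x) (e i (a k)) y (e j x)
  have := dist_triangle_left y (e j x) (e j (a k))
  rw [dist_comm (e j (a k)) (e j x)] at this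
  linarith

/-- For a separable complete space `X`, the isometry group has countably many countable open
covers such that every filter meeting all of them converges. -/
theorem exists_complete_sequence_of_covers [CompleteSpace X] [TopologicalSpace.SeparableSpace X]
    [Nonempty X] : ∃ B : ℕ → ℕ × ℕ → Set (X ≃ᵢ X), (∀ n i, IsOpen (B n i)) ∧
      (∀ n, ⋃ i, B n i = univ) ∧
      ∀ F : Filter (X ≃ᵢ X), NeBot F → (∀ n, ∃ i, B n i ∈ F) → ∃ p, F ≤ 𝓝 p := by
  have ha := TopologicalSpace.denseRange_denseSeq X
  set a := TopologicalSpace.denseSeq X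
  -- `n` codes a point of the dense sequence and a precision; `i` picks approximate values of `f`
  -- and of `f⁻¹` there.
  refine ⟨fun n i => {f | dist (f (a n.unpair.1)) (a i.1) < 1 / (n.unpair.2 + 1 : ℝ) ∧
    dist (f⁻¹ (a n.unpair.1)) (a i.2) < 1 / (n.unpair.2 + 1 : ℝ)}, fun n i => ?_, fun n => ?_, ?_⟩
  · exact (isOpen_lt ((continuous_apply_const _).dist continuous_const) continuous_const).inter
      (isOpen_lt (((continuous_apply_const _).comp continuous_inv).dist continuous_const)
        continuous_const)
  · refine eq_univ_of_forall fun f => ?_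
    have hpos : 0 < 1 / (n.unpair.2 + 1 : ℝ) := Nat.one_div_pos_of_nat
    obtain ⟨i, hi⟩ := ha.exists_dist_lt (f (a n.unpair.1)) hpos
    obtain ⟨j, hj⟩ := ha.exists_dist_lt (f⁻¹ (a n.unpair.1)) hpos
    exact mem_iUnion.2 ⟨(i, j), hi, hj⟩
  · intro F _ hF
    refine exists_le_nhds (exists_tendsto_of_denseRange (e := id) ha fun k n => ?_)
      (exists_tendsto_of_denseRange (e := fun f => f⁻¹) ha fun k n => ?_)
    all_goals
      obtain ⟨i, hi⟩ := hF (Nat.pair k n)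
      simp only [Nat.unpair_pair] at hi
    · exact ⟨_, mem_of_superset hi fun f hf => hf.1⟩
    · exact ⟨_, mem_of_superset hi fun f hf => hf.2⟩

end IsometryEquiv

/-! ### Closed graph theorems -/

section ClosedGraph

variable {K P : Type*} [Group K] [TopologicalSpace K] [IsTopologicalGroup K]
  [Group P] [TopologicalSpace P] [IsTopologicalGroup P]

/-- A homomorphism with separable range from a Baire group is nearly continuous. -/
theorem MonoidHom.closure_preimage_mem_nhds [BaireSpace K] (h : K →* P)
    (hsep : ∀ W ∈ 𝓝 (1 : P), ∃ t : Set K, t.Countable ∧ ∀ k, ∃ a ∈ t, h (a⁻¹ * k) ∈ W)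
    {V : Set P} (hV : IsOpen V) {k : K} (hk : h k ∈ V) : closure (h ⁻¹' V) ∈ 𝓝 k := by
  have hV1 : {p | h k * p ∈ V} ∈ 𝓝 (1 : P) :=
    (hV.preimage (continuous_const_mul (h k))).mem_nhds (by simpa using hk)
  obtain ⟨W, hW, hWV⟩ := exists_nhds_split_inv hV1
  obtain ⟨t, ht, htW⟩ := hsep W⁻¹ (inv_mem_nhds_one P hW)
  have := ht.to_subtype
  -- By Baire, one of countably many closures has interior; translating by `k * d⁻¹`, with `d` in
  -- both that interior and the set itself, moves it to `k`.
  obtain ⟨⟨a, ha⟩, c, hc⟩ := nonempty_interior_of_iUnion_of_closed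
    (f := fun a : t => closure {x | h (a.1⁻¹ * x) ∈ W⁻¹}) (fun _ => isClosed_closure)
    (eq_univ_of_forall fun x => by
      obtain ⟨a, ha, hx⟩ := htW x
      exact mem_iUnion.2 ⟨⟨a, ha⟩, subset_closure hx⟩)
  obtain ⟨d, hd, hdW⟩ := mem_closure_iff_nhds.1 (interior_subset hc) _
    (isOpen_interior.mem_nhds hc)
  have hN : {x | d * k⁻¹ * x ∈ interior (closure {x | h (a⁻¹ * x) ∈ W⁻¹})} ∈ 𝓝 k :=
    (isOpen_interior.preimage (continuous_const_mul (d * k⁻¹))).mem_nhds (by simpa using hd)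
  refine mem_of_superset hN fun x hx => ?_
  have hmaps : MapsTo (fun y => k * d⁻¹ * y) {x | h (a⁻¹ * x) ∈ W⁻¹} (h ⁻¹' V) := by
    intro y hy
    have := hWV _ hdW _ hy
    simp only [mem_preimage, map_mul, map_inv] at this ⊢
    simpa [mul_assoc] using this
  simpa [mul_assoc] using
    map_mem_closure (continuous_const_mul (k * d⁻¹)) (interior_subset hx) hmaps

/-- The points of `h ⁻¹' V` whose images lie in the cover elements indexed by `s`. -/
def coverPreimage {K P ι : Type*} (h : K → P) (B : ℕ → ι → Set P) (V : Set P) : List ι → Set K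
  | [] => h ⁻¹' V
  | i :: s => coverPreimage h B V s ∩ h ⁻¹' B s.length i

theorem coverPreimage_eq_preimage {K P ι : Type*} [TopologicalSpace P] (h : K → P)
    {B : ℕ → ι → Set P} {V : Set P} (hV : IsOpen V) (hB : ∀ n i, IsOpen (B n i)) (s : List ι) :
    ∃ U, IsOpen U ∧ coverPreimage h B V s = h ⁻¹' U := by
  induction s with
  | nil => exact ⟨V, hV, rfl⟩
  | cons i s ih =>
    obtain ⟨U, hU, hs⟩ := ih
    exact ⟨U ∩ B s.length i, hU.inter (hB _ _), by rw [coverPreimage, hs, preimage_inter]⟩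

/-- The sets `E s` form a countable tree, each node being the union of its children, so failing to
pass from a node to a child is a nowhere dense event. Any other `x` follows an infinite branch;
completeness gives a limit in `closure V`, which the closed graph identifies with `h x`. -/
theorem isMeagre_closure_preimage_diff {K P ι : Type*} [TopologicalSpace K] [TopologicalSpace P]
    [Countable ι] {h : K → P} (hgraph : IsClosed {p : K × P | h p.1 = p.2})
    (hnear : ∀ V : Set P, IsOpen V → ∀ k, h k ∈ V → closure (h ⁻¹' V) ∈ 𝓝 k)
    {B : ℕ → ι → Set P} (hB : ∀ n i, IsOpen (B n i)) (hcov : ∀ n, ⋃ i, B n i = univ)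
    (hcomplete : ∀ F : Filter P, NeBot F → (∀ n, ∃ i, B n i ∈ F) → ∃ p, F ≤ 𝓝 p)
    {V : Set P} (hV : IsOpen V) :
    IsMeagre (interior (closure (h ⁻¹' V)) \ h ⁻¹' closure V) := by
  set E := coverPreimage h B V with hE
  have hEO : ∀ s, E s ⊆ interior (closure (E s)) := by
    intro s k hk
    obtain ⟨U, hU, hs⟩ := coverPreimage_eq_preimage h hV hB s
    rw [mem_interior_iff_mem_nhds]
    simp only [hE] at hk ⊢
    rw [hs] at hk ⊢
    exact hnear U hU k hk
  have hbad : ∀ s, IsMeagre (interior (closure (E s)) \ ⋃ i, interior (closure (E (i :: s)))) := by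
    intro s
    refine IsNowhereDense.isMeagre
      (IsNowhereDense.mono (sdiff_subset_sdiff_left interior_subset) ?_)
    have hcl : IsClosed (closure (E s) \ ⋃ i, interior (closure (E (i :: s)))) :=
      isClosed_closure.sdiff (isOpen_iUnion fun _ => isOpen_interior)
    rw [hcl.isNowhereDense_iff, eq_empty_iff_forall_notMem]
    intro x hx
    obtain ⟨y, hy, hys⟩ := mem_closure_iff_nhds.1 (interior_subset hx).1 _
      (isOpen_interior.mem_nhds hx)
    obtain ⟨i, hi⟩ := mem_iUnion.1 ((hcov s.length).ge (mem_univ (h y)))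
    exact (interior_subset hy).2 (mem_iUnion.2 ⟨i, hEO _ ⟨hys, hi⟩⟩)
  refine (isMeagre_iUnion hbad).mono ?_
  rintro x ⟨hx, hxV⟩
  by_contra hxM
  simp only [mem_iUnion, Set.mem_sdiff, not_exists, not_and, not_forall, not_not] at hxM
  have : Nonempty ι := (mem_iUnion.1 ((hcov 0).ge (mem_univ (h x)))).nonempty
  choose! next hnext using hxM
  let s : ℕ → List ι := fun n => Nat.rec [] (fun _ l => next l :: l) n
  have hlen : ∀ n, (s n).length = n := by
    intro n
    induction n with
    | zero => rfl
    | succ n ih => exact congrArg Nat.succ ih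
  have hxs : ∀ n, x ∈ interior (closure (E (s n))) := by
    intro n
    induction n with
    | zero => exact hx
    | succ n ih => exact hnext _ ih
  have hanti : Antitone fun n => E (s n) := antitone_nat_of_succ_le fun n => inter_subset_left
  let F : Filter K := ⨅ n, 𝓝 x ⊓ 𝓟 (E (s n))
  have hFE : ∀ n, E (s n) ∈ F := fun n =>
    mem_iInf_of_mem n (mem_inf_of_right (mem_principal_self _))
  have hFx : F ≤ 𝓝 x := (iInf_le _ 0).trans inf_le_left
  have hne : NeBot F := by
    refine iInf_neBot_of_directed' (Antitone.directed_ge fun m n hmn =>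
      inf_le_inf_left _ (principal_mono.2 (hanti hmn))) fun n => ?_
    exact mem_closure_iff_clusterPt.1 (interior_subset (hxs n))
  obtain ⟨p, hp⟩ := hcomplete (F.map h) inferInstance fun n =>
    ⟨next (s n), mem_map.2 <| mem_of_superset (hFE (n + 1)) fun k hk => by
      have := hk.2
      rwa [show List.length _ = n from hlen n] at this⟩
  have hxp : (x, p) ∈ {p : K × P | h p.1 = p.2} :=
    hgraph.mem_of_tendsto (f := fun k => (k, h k)) (b := F) (Tendsto.prodMk_nhds hFx hp)
      (Eventually.of_forall fun _ => rfl)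
  refine hxV ?_
  rw [mem_preimage, show h x = p from hxp]
  exact mem_closure_of_tendsto hp (hFE 0)

/-- Closed graph theorem for homomorphisms from a Baire group, with separable range, into a
group with a complete sequence of countable open covers. -/
theorem MonoidHom.continuous_of_isClosed_graph [BaireSpace K] {ι : Type*} [Countable ι]
    (h : K →* P) (hgraph : IsClosed {p : K × P | h p.1 = p.2})
    (hsep : ∀ W ∈ 𝓝 (1 : P), ∃ t : Set K, t.Countable ∧ ∀ k, ∃ a ∈ t, h (a⁻¹ * k) ∈ W)
    {B : ℕ → ι → Set P} (hB : ∀ n i, IsOpen (B n i)) (hcov : ∀ n, ⋃ i, B n i = univ)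
    (hcomplete : ∀ F : Filter P, NeBot F → (∀ n, ∃ i, B n i ∈ F) → ∃ p, F ≤ 𝓝 p) :
    Continuous h := by
  have hnear : ∀ V : Set P, IsOpen V → ∀ k, h k ∈ V → closure (h ⁻¹' V) ∈ 𝓝 k :=
    fun V hV k hk => h.closure_preimage_mem_nhds hsep hV hk
  refine continuous_of_continuousAt_one h ?_
  rw [ContinuousAt, map_one]
  intro W hW
  obtain ⟨V₀, hV₀, hV₀W⟩ := exists_nhds_split_inv hW
  obtain ⟨V₁, hV₁, hV₁c, hV₁V⟩ := exists_mem_nhds_isClosed_subset hV₀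
  obtain ⟨V, hVV₁, hVo, hV1⟩ := mem_nhds_iff.1 hV₁
  have hclV : closure V ⊆ V₀ := (closure_minimal hVV₁ hV₁c).trans hV₁V
  have hM := isMeagre_closure_preimage_diff hgraph hnear hB hcov hcomplete hVo
  set O := interior (closure (h ⁻¹' V))
  have hO1 : (1 : K) ∈ O := mem_interior_iff_mem_nhds.2 (hnear V hVo 1 (by simpa using hV1))
  change h ⁻¹' W ∈ 𝓝 1
  refine mem_of_superset (isOpen_interior.mem_nhds hO1) fun g hg => ?_
  -- `O` and its translate by `g` meet in a non-meagre set, so some `y` has both `h y` and `h (g⁻¹ *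
  -- y)` in `closure V`; their quotient is `h g`.
  have hM' : IsMeagre ((fun y => g⁻¹ * y) ⁻¹' (O \ h ⁻¹' closure V)) :=
    hM.preimage_of_isOpenMap (continuous_const_mul _) (isOpenMap_mul_left _)
  have hOg : IsOpen (O ∩ (fun y => g⁻¹ * y) ⁻¹' O) :=
    isOpen_interior.inter (isOpen_interior.preimage (continuous_const_mul _))
  have hne : (O ∩ (fun y => g⁻¹ * y) ⁻¹' O).Nonempty := ⟨g, hg, by simpa using hO1⟩
  have hnot := not_isMeagre_of_isOpen hOg hne
  have : ∃ y ∈ O ∩ (fun y => g⁻¹ * y) ⁻¹' O, h y ∈ closure V ∧ h (g⁻¹ * y) ∈ closure V := by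
    by_contra! hcon
    refine hnot ((hM.union hM').mono fun y hy => ?_)
    by_cases hyV : h y ∈ closure V
    · exact Or.inr ⟨hy.2, hcon y hy hyV⟩
    · exact Or.inl ⟨hy.1, hyV⟩
  obtain ⟨y, -, hy1, hy2⟩ := this
  have := hV₀W _ (hclV hy1) _ (hclV hy2)
  simpa [div_eq_mul_inv] using this

/-- The preimage of `C` is the projection, along a compact factor, of the part of the graph over
`C`. -/
theorem continuous_of_isClosed_graph_of_compactSpace {K P : Type*} [TopologicalSpace K]
    [TopologicalSpace P] [CompactSpace P] {h : K → P}
    (hgraph : IsClosed {p : K × P | h p.1 = p.2}) : Continuous h := by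
  refine continuous_iff_isClosed.2 fun C hC => ?_
  convert isClosedMap_fst_of_compactSpace _ (hgraph.inter (hC.preimage continuous_snd)) using 1
  ext k
  simp [eq_comm]

end ClosedGraph

/-! ### Isometric actions detecting neighborhoods of the identity -/

section Separation

/-- A decreasing sequence of entourages is refined by a uniformly equivalent pseudodistance. -/
theorem exists_pseudodist_of_entourages {X : Type*} {E : ℕ → Set (X × X)}
    (hanti : Antitone E) (hrefl : ∀ n x, (x, x) ∈ E n)
    (hsymm : ∀ n x y, (x, y) ∈ E n → (y, x) ∈ E n)
    (hcomp : ∀ n x y z, (x, y) ∈ E (n + 1) → (y, z) ∈ E (n + 1) → (x, z) ∈ E n) :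
    ∃ ρ : X → X → ℝ, (∀ x y, 0 ≤ ρ x y) ∧ (∀ x, ρ x x = 0) ∧
      (∀ x y z, |ρ x y - ρ x z| ≤ ρ z y) ∧
      (∀ n, ∃ δ > 0, ∀ x y, ρ x y < δ → (x, y) ∈ E n) ∧
      ∀ ε > 0, ∃ n, ∀ x y, (x, y) ∈ E n → ρ x y < ε := by
  have hbasis : (⨅ n, 𝓟 (E n)).HasAntitoneBasis E := HasAntitoneBasis.iInf_principal hanti
  let u : UniformSpace X := UniformSpace.ofCore
    { uniformity := ⨅ n, 𝓟 (E n)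
      refl := by
        refine le_iInf fun n => principal_mono.2 ?_
        rintro ⟨x, y⟩ (rfl : x = y)
        exact hrefl n x
      symm := (hbasis.tendsto_iff hbasis.toHasBasis).2 fun n _ =>
        ⟨n, trivial, fun p hp => hsymm n _ _ hp⟩
      comp := by
        refine hbasis.toHasBasis.ge_iff.2 fun n _ => ?_
        refine mem_of_superset (mem_lift' (hbasis.mem (n + 1))) ?_
        rintro ⟨x, y⟩ ⟨z, hxz, hzy⟩
        exact hcomp n x z y hxz hzy }
  have hu : (𝓤 X).HasAntitoneBasis E := hbasis
  have : IsCountablyGenerated (𝓤 X) := hu.1.isCountablyGenerated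
  let I : PseudoMetricSpace X := UniformSpace.pseudoMetricSpace X
  refine ⟨fun x y => dist x y, fun x y => dist_nonneg, dist_self, fun x y z => ?_,
    fun n => ?_, fun ε hε => ?_⟩
  · have h1 := dist_triangle x z y
    have h2 := dist_triangle_right x z y
    exact abs_sub_le_iff.2 ⟨by linarith, by linarith⟩
  · obtain ⟨δ, hδ, h⟩ := Metric.mem_uniformity_dist.1 (hu.mem n)
    exact ⟨δ, hδ, fun x y => @h x y⟩
  · obtain ⟨n, -, hn⟩ := hu.1.mem_iff.1 (Metric.dist_mem_uniformity hε)
    exact ⟨n, fun x y hxy => hn hxy⟩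

variable {G : Type*} [Group G] [TopologicalSpace G] [IsTopologicalGroup G]

theorem exists_seq_nhds_one_mul_subset {U : Set G} (hU : U ∈ 𝓝 1) :
    ∃ V : ℕ → Set G, V 0 ⊆ U ∧ ∀ n, V n ∈ 𝓝 1 ∧ (V n)⁻¹ = V n ∧ V (n + 1) * V (n + 1) ⊆ V n := by
  choose! φ hφ hφc hφinv hφmul using
    fun (W : Set G) (hW : W ∈ 𝓝 1) => exists_closed_nhds_one_inv_eq_mul_subset hW
  let V : ℕ → Set G := fun n => Nat.rec (φ U) (fun _ W => φ W) n
  have hV : ∀ n, V n ∈ 𝓝 1 := by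
    intro n
    induction n with
    | zero => exact hφ U hU
    | succ n ih => exact hφ _ ih
  refine ⟨V, fun x hx => hφmul U hU ?_, fun n => ⟨hV n, ?_, hφmul _ (hV n)⟩⟩
  · exact ⟨x, hx, 1, mem_of_mem_nhds (hφ U hU), mul_one x⟩
  · cases n with
    | zero => exact hφinv U hU
    | succ n => exact hφinv _ (hV n)

/-- A left uniformly continuous bounded function separating the identity from the complement
of a given neighborhood. -/
theorem exists_boundedContinuousFunction_left_uniform {U : Set G} (hU : U ∈ 𝓝 1) :
    ∃ f : G →ᵇ ℝ, f 1 = 0 ∧ (∀ x ∉ U, 1 ≤ f x) ∧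
      ∀ ε > 0, ∃ V ∈ 𝓝 (1 : G), ∀ x, ∀ v ∈ V, dist (f (x * v)) (f x) ≤ ε := by
  obtain ⟨V, hVU, hV⟩ := exists_seq_nhds_one_mul_subset hU
  have hsub : ∀ n, V (n + 1) ⊆ V n := fun n x hx =>
    (hV n).2.2 ⟨x, hx, 1, mem_of_mem_nhds (hV (n + 1)).1, mul_one x⟩
  obtain ⟨ρ, hnonneg, hself, htri, hρV, hVρ⟩ := exists_pseudodist_of_entourages
    (E := fun n => {p : G × G | p.1⁻¹ * p.2 ∈ V n})
    (antitone_nat_of_succ_le fun n p hp => hsub n hp)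
    (fun n x => by simpa using mem_of_mem_nhds (hV n).1)
    (fun n x y hxy => by
      change y⁻¹ * x ∈ V n
      rw [← (hV n).2.1, Set.mem_inv]
      simpa using hxy)
    (fun n x y z hxy hyz => (hV n).2.2 ⟨_, hxy, _, hyz, by simp [mul_assoc]⟩)
  obtain ⟨δ, hδ, hδV⟩ := hρV 0
  -- Dividing by `δ` works because `ρ 1 y < δ` forces `y ∈ V 0 ⊆ U`.
  let f : G → ℝ := fun y => min 1 (ρ 1 y / δ)
  have huc : ∀ ε > 0, ∃ V ∈ 𝓝 (1 : G), ∀ x, ∀ v ∈ V, dist (f (x * v)) (f x) ≤ ε := by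
    intro ε hε
    obtain ⟨n, hn⟩ := hVρ (ε * δ) (mul_pos hε hδ)
    refine ⟨V n, (hV n).1, fun x v hv => ?_⟩
    have h1 : ρ x (x * v) < ε * δ := hn x (x * v) (by simpa using hv)
    calc dist (f (x * v)) (f x)
        ≤ max |1 - 1| |ρ 1 (x * v) / δ - ρ 1 x / δ| := abs_min_sub_min_le_max _ _ _ _
      _ = |ρ 1 (x * v) - ρ 1 x| / δ := by
          rw [← sub_div, abs_div, abs_of_pos hδ, sub_self, abs_zero, max_eq_right (by positivity)]
      _ ≤ ε := by
          rw [div_le_iff₀ hδ]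
          exact (htri _ _ _).trans h1.le
  have hcont : Continuous f := by
    refine continuous_iff_continuousAt.2 fun x => Metric.tendsto_nhds.2 fun ε hε => ?_
    obtain ⟨W, hW, hWf⟩ := huc (ε / 2) (half_pos hε)
    have : {y | x⁻¹ * y ∈ W} ∈ 𝓝 x :=
      (continuous_const_mul x⁻¹).continuousAt.preimage_mem_nhds (by simpa using hW)
    filter_upwards [this] with y hy
    have := hWf x _ hy
    rw [mul_inv_cancel_left] at this
    linarith
  refine ⟨BoundedContinuousFunction.ofNormedAddCommGroup f hcont 1 fun x => ?_, ?_, ?_, huc⟩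
  · rw [Real.norm_of_nonneg (le_min zero_le_one (div_nonneg (hnonneg _ _) hδ.le))]
    exact min_le_left _ _
  · simp [f, hself]
  · intro x hx
    refine le_min le_rfl ((one_le_div hδ).2 (not_lt.1 fun h => hx (hVU ?_)))
    simpa using hδV 1 x h

/-- Every neighborhood of the identity is detected by a continuous isometric action on a complete
metric space with a dense orbit. -/
theorem exists_isometric_action {G : Type u} [Group G] [TopologicalSpace G] [IsTopologicalGroup G]
    {U : Set G} (hU : U ∈ 𝓝 1) :
    ∃ (X : Type u) (_ : MetricSpace X) (_ : CompleteSpace X) (q : G →* (X ≃ᵢ X)) (x₀ : X),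
      Continuous (fun g => q g x₀) ∧ DenseRange (fun g => q g x₀) ∧
        ∀ g, dist (q g x₀) x₀ < 1 → g ∈ U := by
  obtain ⟨f, hf1, hfU, hf⟩ := exists_boundedContinuousFunction_left_uniform hU
  -- `G` acts by right translation on the orbit closure of `f`; evaluating at `1` shows that `T g f`
  -- is at distance at least `1` from `f` when `g ∉ U`.
  let T : G → (G →ᵇ ℝ) → (G →ᵇ ℝ) := fun g φ => φ.compContinuous ⟨fun x => x * g, by fun_prop⟩
  have hT : ∀ g φ x, T g φ x = φ (x * g) := fun _ _ _ => rfl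
  have hTT : ∀ g g' φ, T (g * g') φ = T g (T g' φ) := fun g g' φ => by
    ext x
    simp [hT, mul_assoc]
  have hT1 : ∀ φ, T 1 φ = φ := fun φ => by
    ext x
    simp [hT]
  have hTle : ∀ g φ ψ, dist (T g φ) (T g ψ) ≤ dist φ ψ := fun g φ ψ =>
    (BoundedContinuousFunction.dist_le dist_nonneg).2 fun x =>
      BoundedContinuousFunction.dist_coe_le_dist (f := φ) (g := ψ) (x * g)
  have hTiso : ∀ g, Isometry (T g) := fun g => Isometry.of_dist_eq fun φ ψ => by
    refine le_antisymm (hTle g φ ψ) ?_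
    have := hTle g⁻¹ (T g φ) (T g ψ)
    rwa [← hTT, ← hTT, inv_mul_cancel, hT1, hT1] at this
  let S : Set (G →ᵇ ℝ) := closure (range fun g => T g f)
  have hTS : ∀ g, MapsTo (T g) S S := fun g φ hφ =>
    map_mem_closure (hTiso g).continuous hφ (by
      rintro _ ⟨g', rfl⟩
      exact ⟨g * g', hTT g g' f⟩)
  let e : G → (S ≃ᵢ S) := fun g =>
    { toFun := (hTS g).restrict
      invFun := (hTS g⁻¹).restrict
      left_inv := fun φ => Subtype.ext (by
        change T g⁻¹ (T g φ) = φ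
        rw [← hTT, inv_mul_cancel, hT1])
      right_inv := fun φ => Subtype.ext (by
        change T g (T g⁻¹ φ) = φ
        rw [← hTT, mul_inv_cancel, hT1])
      isometry_toFun := fun φ ψ => hTiso g φ ψ }
  let q : G →* (S ≃ᵢ S) :=
    { toFun := e
      map_one' := by
        ext1 φ
        exact Subtype.ext (hT1 φ)
      map_mul' := fun g g' => by
        ext1 φ
        exact Subtype.ext (hTT g g' φ) }
  let x₀ : S := ⟨f, subset_closure ⟨1, hT1 f⟩⟩
  have hq : ∀ g, (q g x₀ : G →ᵇ ℝ) = T g f := fun _ => rfl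
  refine ⟨S, inferInstance, isClosed_closure.completeSpace_coe, q, x₀, ?_, ?_, fun g hg => ?_⟩
  · refine continuous_iff_continuousAt.2 fun g => Metric.tendsto_nhds.2 fun ε hε => ?_
    obtain ⟨W, hW, hWf⟩ := hf (ε / 2) (half_pos hε)
    have : {y | g⁻¹ * y ∈ W} ∈ 𝓝 g :=
      (continuous_const_mul g⁻¹).continuousAt.preimage_mem_nhds (by simpa using hW)
    filter_upwards [this] with y hy
    refine lt_of_le_of_lt ?_ (half_lt_self hε)
    rw [Subtype.dist_eq, hq, hq]
    refine (BoundedContinuousFunction.dist_le (half_pos hε).le).2 fun x => ?_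
    simpa [hT, mul_assoc] using hWf (x * g) _ hy
  · intro φ
    rw [closure_subtype]
    convert φ.2
    rw [← range_comp]
    rfl
  · by_contra hgU
    have h1 := BoundedContinuousFunction.dist_coe_le_dist (f := T g f) (g := f) 1
    rw [Subtype.dist_eq, hq] at hg
    rw [hT, one_mul, hf1, Real.dist_eq, sub_zero] at h1
    exact absurd (lt_of_le_of_lt ((hfU g hgU).trans (le_abs_self _)) (h1.trans_lt hg))
      (lt_irrefl _)

end Separation

/-! ### Consequences of c-compactness and change of universe -/

theorem IsCCompactGroup.subgroup {G : Type u} [Group G] [TopologicalSpace G]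
    (hc : IsCCompactGroup.{u} G) {S : Subgroup G} (hS : IsClosed (S : Set G)) :
    IsCCompactGroup.{u} S := by
  intro H _ _ _ _ T hT
  have himg : IsClosed ((T.map (S.subtype.prodMap (MonoidHom.id H)) : Subgroup (G × H)) :
      Set (G × H)) :=
    (hS.isClosedEmbedding_subtypeVal.prodMap Topology.IsClosedEmbedding.id).isClosedMap _ hT
  convert hc H _ himg using 2
  rw [Subgroup.map_map]
  rfl

theorem IsCCompactGroup.isClosed_range {G H : Type u} [Group G] [TopologicalSpace G]
    [Group H] [TopologicalSpace H] [IsTopologicalGroup H] [T2Space H]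
    (hc : IsCCompactGroup.{u} G) (φ : G →* H) (hφ : Continuous φ) : IsClosed (range φ) := by
  have hgraph : IsClosed (φ.graph : Set (G × H)) :=
    isClosed_eq (hφ.comp continuous_fst) continuous_snd
  convert hc H _ hgraph
  ext y
  simp

/-- Each point is the limit of an ultrafilter on `G`, which determines it by the Hausdorff property.
-/
theorem small_of_denseRange {G : Type u} {K : Type v} [TopologicalSpace K] [T2Space K]
    {m : G → K} (hm : DenseRange m) : Small.{u} K := by
  have hlim : ∀ k, ∃ F : Ultrafilter G, Tendsto m F (𝓝 k) := by
    intro k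
    have : NeBot (comap m (𝓝 k)) := comap_neBot_iff.2 fun t ht => by
      obtain ⟨_, hy, g, rfl⟩ := mem_closure_iff_nhds.1 (hm k) t ht
      exact ⟨g, hy⟩
    exact ⟨Ultrafilter.of _, tendsto_comap.mono_left (Ultrafilter.of_le _)⟩
  choose F hF using hlim
  refine small_of_injective (f := F) fun k k' hkk' => ?_
  exact tendsto_nhds_unique (hF k) (hkk' ▸ hF k')

/-- The compact group may be taken in the universe of `G`. -/
theorem IsMaximallyAlmostPeriodic.exists_same_universe {G : Type u} [Group G] [TopologicalSpace G]
    (h : IsMaximallyAlmostPeriodic.{u, v} G) : IsMaximallyAlmostPeriodic.{u, u} G := by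
  obtain ⟨K, _, _, _, _, _, m, hm, hinj⟩ := h
  -- `K` itself may be too large; the closure of the range contains a dense image of `G`, so it is
  -- small.
  let L := m.range.topologicalClosure
  let m' : G →* L := m.codRestrict L fun g => m.range.le_topologicalClosure ⟨g, rfl⟩
  have hm' : Continuous m' := hm.subtype_mk _
  have hdense : DenseRange m' := by
    intro x
    rw [closure_subtype, ← range_comp]
    exact x.2
  have : CompactSpace L :=
    isCompact_iff_compactSpace.1 m.range.isClosed_topologicalClosure.isCompact
  have := small_of_denseRange hdense
  let e : L ≃ₜ Shrink.{u} L := Shrink.homeomorph L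
  let e' : L ≃* Shrink.{u} L := (Shrink.mulEquiv (α := L)).symm
  have : IsTopologicalGroup (Shrink.{u} L) := by
    have : IsInducing e'.symm := e.symm.isInducing
    exact this.topologicalGroup e'.symm
  exact ⟨Shrink.{u} L, inferInstance, inferInstance, this, e.t2Space, e.compactSpace,
    e'.toMonoidHom.comp m', e.continuous.comp hm', fun x y hxy => hinj
      (congrArg Subtype.val (e'.injective hxy))⟩

/-- Relative to a coarser Hausdorff group topology, continuous homomorphisms of a c-compact group
have closed graphs. -/
theorem IsCCompactGroup.isClosed_graph {G K P : Type u} [Group G] [TopologicalSpace G]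
    [Group K] [TopologicalSpace K] [IsTopologicalGroup K] [T2Space K]
    [Group P] [TopologicalSpace P] [IsTopologicalGroup P] [T2Space P]
    (hc : IsCCompactGroup.{u} G) (m : G ≃* K) (hm : Continuous m) (q : G →* P)
    (hq : Continuous q) :
    IsClosed {p : K × P | q.comp m.symm.toMonoidHom p.1 = p.2} := by
  convert hc.isClosed_range (m.toMonoidHom.prod q) (hm.prodMk hq)
  ext ⟨k, p⟩
  constructor
  · rintro (rfl : q (m.symm k) = p)
    exact ⟨m.symm k, by simp⟩
  · rintro ⟨g, hg⟩
    obtain ⟨rfl, rfl⟩ := Prod.ext_iff.1 hg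
    simp

/-! ### From continuity of actions to compactness -/

/-- Isometries are equicontinuous, so continuity along a dense orbit extends to every point. -/
theorem continuous_isometric_action {G X : Type*} [Group G] [TopologicalSpace G]
    [IsTopologicalGroup G] [MetricSpace X] {q : G →* (X ≃ᵢ X)} {x₀ : X}
    (hq : Continuous fun g => q g x₀) (hd : DenseRange fun g => q g x₀) : Continuous q := by
  refine IsometryEquiv.continuous_iff_forall_apply.2 fun x => continuous_iff_continuousAt.2
    fun g => Metric.tendsto_nhds.2 fun ε hε => ?_
  obtain ⟨a, ha⟩ := hd.exists_dist_lt x (ε := ε / 3) (by linarith)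
  have hcont : Continuous fun g => q (g * a) x₀ := hq.comp (continuous_mul_const a)
  filter_upwards [Metric.tendsto_nhds.1 hcont.continuousAt (ε / 3) (by linarith)] with y hy
  simp only [map_mul, IsometryEquiv.mul_apply] at hy
  have h1 := (q y).isometry.dist_eq x (q a x₀)
  have h2 := (q g).isometry.dist_eq x (q a x₀)
  have := dist_triangle4_right (q y x) (q g x) (q y (q a x₀)) (q g (q a x₀))
  linarith

/-- A c-compact group with a continuous bijection onto a compact group is compact as soon as its
isometric actions factor continuously. -/
theorem compactSpace_of_continuous_actions {G K : Type u} [Group G] [TopologicalSpace G]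
    [IsTopologicalGroup G] [Group K] [TopologicalSpace K] [IsTopologicalGroup K] [CompactSpace K]
    (m : G ≃* K)
    (h : ∀ (X : Type u) [MetricSpace X] [CompleteSpace X] (q : G →* (X ≃ᵢ X)) (x₀ : X),
      Continuous q → DenseRange (fun g => q g x₀) →
        Continuous (q.comp m.symm.toMonoidHom)) : CompactSpace G := by
  have hcont : Continuous m.symm := by
    refine continuous_of_continuousAt_one m.symm ?_
    rw [ContinuousAt, map_one]
    intro U hU
    obtain ⟨X, _, _, q, x₀, hq, hd, hqU⟩ := exists_isometric_action hU
    have hcont := h X q x₀ (continuous_isometric_action hq hd) hd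
    have hx : Continuous fun k => q (m.symm k) x₀ :=
      (IsometryEquiv.continuous_apply_const x₀).comp hcont
    have := hx.continuousAt.preimage_mem_nhds
      (Metric.ball_mem_nhds (q (m.symm 1) x₀) one_pos)
    change m.symm ⁻¹' U ∈ 𝓝 1
    filter_upwards [this] with k hk
    refine hqU _ ?_
    simpa using hk
  exact m.symm.surjective.compactSpace hcont

/-- A separable c-compact group with a continuous bijection onto a compact group is compact. -/
theorem compactSpace_of_separable {G K : Type u} [Group G] [TopologicalSpace G]
    [IsTopologicalGroup G] [TopologicalSpace.SeparableSpace G] [Group K] [TopologicalSpace K]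
    [IsTopologicalGroup K] [CompactSpace K] [T2Space K] (hc : IsCCompactGroup.{u} G)
    (m : G ≃* K) (hm : Continuous m) : CompactSpace G := by
  refine compactSpace_of_continuous_actions m fun X _ _ q x₀ hq hd => ?_
  have : Nonempty X := ⟨x₀⟩
  have : TopologicalSpace.SeparableSpace X :=
    hd.separableSpace ((IsometryEquiv.continuous_apply_const x₀).comp hq)
  obtain ⟨B, hB, hcov, hcomplete⟩ := IsometryEquiv.exists_complete_sequence_of_covers (X := X)
  refine MonoidHom.continuous_of_isClosed_graph _ (hc.isClosed_graph m hm q hq) (fun W hW => ?_)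
    hB hcov hcomplete
  obtain ⟨t, ht, htd⟩ := TopologicalSpace.exists_countable_dense G
  refine ⟨m '' t, ht.image m, fun k => ?_⟩
  have hcont : Continuous fun a => q (a⁻¹ * m.symm k) := by fun_prop
  have hW' : (fun a => q (a⁻¹ * m.symm k)) ⁻¹' W ∈ 𝓝 (m.symm k) :=
    hcont.continuousAt.preimage_mem_nhds (by simpa using hW)
  obtain ⟨a, haW, hat⟩ := mem_closure_iff_nhds.1 (htd (m.symm k)) _ hW'
  exact ⟨m a, ⟨a, hat, rfl⟩, by simpa using haW⟩

theorem IsCCompactGroup.compactSpace_range_and_continuous_ofInjective {G K : Type u}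
    [Group G] [TopologicalSpace G]
    [Group K] [TopologicalSpace K] [IsTopologicalGroup K]
    [T2Space K] [CompactSpace K] (hc : IsCCompactGroup.{u} G) (m : G →* K)
    (hm : Continuous m) (hinj : Function.Injective m) :
    CompactSpace m.range ∧ Continuous (MonoidHom.ofInjective hinj) :=
  ⟨isCompact_iff_compactSpace.1 (hc.isClosed_range m hm).isCompact, hm.subtype_mk _⟩

theorem Subgroup.separableSpace_topologicalClosure_closure {G : Type*} [Group G]
    [TopologicalSpace G] [IsTopologicalGroup G] {t : Set G} (ht : t.Countable) :
    TopologicalSpace.SeparableSpace (Subgroup.closure t).topologicalClosure := by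
  have := ht.to_subtype
  let f : FreeGroup t →* G := FreeGroup.lift (↑)
  have hf : Subgroup.closure t = f.range := FreeGroup.closure_eq_range t
  have : Countable (FreeGroup t) := inferInstanceAs (Countable (Quot _))
  rw [hf]
  refine TopologicalSpace.SeparableSpace.of_denseRange
    (fun x => (⟨f x, f.range.le_topologicalClosure ⟨x, rfl⟩⟩ : f.range.topologicalClosure))
    fun y => ?_
  rw [closure_subtype, ← range_comp]
  exact y.2

/-- Otherwise some sequence is `V`-separated, while compactness gives it a Cauchy subsequence. -/
theorem totallyBounded_of_forall_seq_mem_isCompact {X : Type*} [PseudoMetricSpace X] {s : Set X}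
    (h : ∀ u : ℕ → X, (∀ n, u n ∈ s) → ∃ C, IsCompact C ∧ ∀ n, u n ∈ C) : TotallyBounded s := by
  intro V hV
  by_contra! hcon
  obtain ⟨u, hus, hu⟩ : ∃ u : ℕ → X, (∀ n, u n ∈ s) ∧
      ∀ n m, m < n → u m ∉ UniformSpace.ball (u n) V := by
    simp only [not_subset, mem_iUnion₂, not_exists, exists_prop] at hcon
    simpa only [forall_and, forall_mem_image, not_and] using! seq_of_forall_finite_exists hcon
  obtain ⟨C, hC, huC⟩ := h u hus
  obtain ⟨x, -, φ, hφ, hx⟩ := hC.tendsto_subseq huC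
  obtain ⟨N, hN⟩ := hx.cauchySeq.mem_entourage hV
  exact hu _ _ (hφ N.lt_succ_self) (hN (N + 1) N N.le_succ le_rfl)

theorem mainTheorem5 (G : Type u) [Group G] [TopologicalSpace G] [IsTopologicalGroup G]
    [T2Space G] (hc : IsCCompactGroup.{u} G) (hmap : IsMaximallyAlmostPeriodic.{u, v} G) :
    CompactSpace G := by
  obtain ⟨K, _, _, _, _, _, m, hm, hinj⟩ := hmap.exists_same_universe
  -- The separable case, applied to the closed subgroup generated by `t`.
  have hsep : ∀ t : Set G, t.Countable → ∃ S : Set G, t ⊆ S ∧ IsCompact S := by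
    intro t ht
    have := Subgroup.separableSpace_topologicalClosure_closure ht
    set S := (Subgroup.closure t).topologicalClosure
    have hcS := hc.subgroup (Subgroup.closure t).isClosed_topologicalClosure
    have hinjS : Function.Injective (m.comp S.subtype) := hinj.comp Subtype.val_injective
    obtain ⟨_, hcont⟩ := hcS.compactSpace_range_and_continuous_ofInjective _
      (hm.comp continuous_subtype_val) hinjS
    have := compactSpace_of_separable hcS (MonoidHom.ofInjective hinjS) hcont
    exact ⟨S, Subgroup.subset_closure.trans (Subgroup.closure t).le_topologicalClosure,
      isCompact_iff_compactSpace.2 this⟩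
  obtain ⟨_, hcont⟩ := hc.compactSpace_range_and_continuous_ofInjective m hm hinj
  refine compactSpace_of_continuous_actions (MonoidHom.ofInjective hinj)
    fun X _ _ q x₀ hq hd => ?_
  have : CompactSpace X := by
    have hqx : Continuous fun g => q g x₀ := (IsometryEquiv.continuous_apply_const x₀).comp hq
    have htb : TotallyBounded (range fun g => q g x₀) := by
      refine totallyBounded_of_forall_seq_mem_isCompact fun u hu => ?_
      choose g hg using hu
      obtain ⟨S, hgS, hS⟩ := hsep (range g) (countable_range g)
      exact ⟨_, hS.image hqx, fun n => ⟨g n, hgS ⟨n, rfl⟩, hg n⟩⟩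
    have := htb.closure
    rw [hd.closure_range] at this
    exact ⟨isCompact_iff_totallyBounded_isComplete.2 ⟨this, isClosed_univ.isComplete⟩⟩
  exact continuous_of_isClosed_graph_of_compactSpace (hc.isClosed_graph _ hcont q hq)
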